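/- All manifolds, tensor fields and maps are smooth, and manifolds are finite-dimensional without boundary. An almost para-Hermitian manifold $(M,h,P)$ is a manifold with a $(1,1)$-tensor field $P$, $P^2=\mathrm{Id}$, and a nondegenerate metric $h$ with $h(PX,Y)=-h(X,PY)$. An almost product Riemannian manifold $(N,g,Q)$ is a manifold with a $(1,1)$-tensor field $Q$, $Q^2=\mathrm{Id}$, and a Riemannian metric $g$ with $g(QX,Y)=g(X,QY)$. In each case $\nabla$ is the Levi-Civita connection of the metric. Put $$S_Q(X,Y)=(\nabla_XQ)Y+Q\big((\nabla_{QX}Q)Y\big),$$ and let $\operatorname{div}P$ be the vector field $\operatorname{div}P=\sum_{a}h(u_a,u_a)(\nabla_{u_a}P)u_a$, for any local orthonormal frame $\{u_a\}$ of $TM$ (so $h(u_a,u_b)=\pm\delta_{ab}$). For a map $F:M\to N$ let $$(\nabla F_*)(X,Y)=\nabla^{F}_{X}(F_*Y)-F_*(\nabla_XY)$$ be its second fundamental form, where $\nabla^F$ is the pull-back to $F^{*}TN$ of the Levi-Civita connection of $g$, and let $\tau(F)=\sum_{i,j}h^{ij}(\nabla F_*)(b_i,b_j)$ be its tension field, where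 $\{b_i\}$ is any local frame of $TM$ and $(h^{ij})$ is the inverse of the matrix $(h(b_i,b_j))$. Proposition. Let $(M,h,P)$ be an almost para-Hermitian manifold, let $(N,g,Q)$ be an almost para-Hermitian manifold or an almost product Riemannian manifold, and let $F:M\to N$ be a map which is either $(P,Q)$-paraholomorphic, $F_*P=QF_*$ (put $\lambda=1$), or $(P,Q)$-anti-paraholomorphic, $F_*P=-QF_*$ (put $\lambda=-1$). Let $\{e_1,\dots,e_m,Pe_1,\dots,Pe_m\}$ be a local orthonormal frame of $TM$ on an open set $U\subseteq M$, and put $h_{ii}=h(e_i,e_i)$ and $e_i'=F_*e_i$. Then on $U$ $$\tau(F)=\sum_{i=1}^m\Big\{h(e_i,e_i)(\nabla F_*)(e_i,e_i)+h(Pe_i,Pe_i)(\nabla F_*)(Pe_i,Pe_i)\Big\}$$ and $$\tau(F)=-Q\Big\{\sum_{i=1}^m h_{ii}\,S_Q(e_i',e_i')-\lambda\,F_*(\operatorname{div}P)\Big\}.$$ -/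

import Mathlib

open scoped Manifold ContDiff Bundle
open Module

noncomputable section

lemma fderivWithin_bilinear_apply {E : Type*} [NormedAddCommGroup E] [NormedSpace ℝ E]
    {G : E → E →L[ℝ] E →L[ℝ] ℝ} {a b : E → E} {s : Set E} {u : E}
    {G₀ : E →L[ℝ] E →L[ℝ] ℝ} {a₀ b₀ : E} (hu : UniqueDiffWithinAt ℝ s u)
    (hG : DifferentiableWithinAt ℝ G s u) (ha : DifferentiableWithinAt ℝ a s u)
    (hb : DifferentiableWithinAt ℝ b s u) (hG₀ : G u = G₀) (ha₀ : a u = a₀) (hb₀ : b u = b₀)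
    (v : E) :
    fderivWithin ℝ (fun y ↦ G y (a y) (b y)) s u v
      = fderivWithin ℝ (fun y ↦ G y a₀ b₀) s u v
        + G₀ (fderivWithin ℝ a s u v) b₀ + G₀ a₀ (fderivWithin ℝ b s u v) := by
  subst hG₀ ha₀ hb₀
  rw [fderivWithin_clm_apply hu (hG.clm_apply ha) hb, fderivWithin_clm_apply hu hG ha,
    fderivWithin_clm_apply hu (hG.clm_apply (differentiableWithinAt_const _))
      (differentiableWithinAt_const _),
    fderivWithin_clm_apply hu hG (differentiableWithinAt_const _)]
  simp
  ring

set_option linter.unusedSectionVars false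

section Geometry

variable {E : Type*} [NormedAddCommGroup E] [NormedSpace ℝ E]
  {H : Type*} [TopologicalSpace H] {I : ModelWithCorners ℝ E H}
  {M : Type*} [TopologicalSpace M] [ChartedSpace H M] [IsManifold I ∞ M]

variable (I M) in
/-- A smooth symmetric nondegenerate `(0,2)`-tensor field (of any signature). -/
structure SemiRiemannianMetric where
  val (x : M) : TangentSpace I x →L[ℝ] TangentSpace I x →L[ℝ] ℝ
  symm (x : M) (v w : TangentSpace I x) : val x v w = val x w v
  nondegenerate (x : M) (v : TangentSpace I x) (hv : ∀ w, val x v w = 0) : v = 0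
  contMDiff : ContMDiff I (I.prod 𝓘(ℝ, E →L[ℝ] E →L[ℝ] ℝ)) ∞
    (fun x ↦ Bundle.TotalSpace.mk' (E →L[ℝ] E →L[ℝ] ℝ) x (val x))

/-- The coordinates of a tangent vector at `y` in the preferred chart at `c`. -/
def toCoord (c y : M) : TangentSpace I y →L[ℝ] E :=
  (trivializationAt E (TangentSpace I) c).continuousLinearMapAt ℝ y

/-- The tangent vector at `y` with given coordinates in the preferred chart at `c`. -/
def ofCoord (c y : M) : E →L[ℝ] TangentSpace I y :=
  (trivializationAt E (TangentSpace I) c).symmL ℝ y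

lemma toCoord_ofCoord {c y : M} (hy : y ∈ (chartAt H c).source) (w : E) :
    toCoord (I := I) c y (ofCoord c y w) = w := by
  simp only [toCoord, ofCoord]
  apply Bundle.Trivialization.continuousLinearMapAt_symmL
  simpa using hy

lemma ofCoord_toCoord {c y : M} (hy : y ∈ (chartAt H c).source) (w : TangentSpace I y) :
    ofCoord c y (toCoord c y w) = w := by
  simp only [toCoord, ofCoord]
  apply Bundle.Trivialization.symmL_continuousLinearMapAt
  simpa using hy

lemma mdifferentiableAt_toCoord {Y : Π x : M, TangentSpace I x} {x : M} :
    MDiffAt (T% Y) x ↔ MDiffAt (fun y ↦ toCoord x y (Y y)) x := by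
  rw [mdifferentiableAt_section]
  refine Filter.EventuallyEq.mdifferentiableAt_iff ?_
  filter_upwards [(chartAt H x).open_source.mem_nhds (mem_chart_source H x)] with y hy
  simp only [toCoord]
  rw [Bundle.Trivialization.continuousLinearMapAt_apply, Bundle.Trivialization.linearMapAt_apply, if_pos]
  simpa using hy

lemma mvfderiv_eq_fderivWithin {W : Type*} [NormedAddCommGroup W] [NormedSpace ℝ W]
    {f : M → W} {x : M} (hf : MDiffAt f x) (v : TangentSpace I x) :
    mvfderiv I f x v
      = fderivWithin ℝ (f ∘ (extChartAt I x).symm) (Set.range I) (extChartAt I x x) v := by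
  simp only [mvfderiv, mfderiv, hf]
  rfl

namespace SemiRiemannianMetric

/-- The metric at `y` in the coordinates of the preferred chart at `c`. -/
def coordMetric (h : SemiRiemannianMetric I M) (c y : M) : E →L[ℝ] E →L[ℝ] ℝ :=
  (ContinuousLinearMap.precomp ℝ (ofCoord c y)) ∘L (h.val y) ∘L (ofCoord c y)

lemma coordMetric_apply (h : SemiRiemannianMetric I M) (c y : M) (v w : E) :
    h.coordMetric c y v w = h.val y (ofCoord c y v) (ofCoord c y w) := rfl

lemma mdifferentiableAt_coordMetric (h : SemiRiemannianMetric I M) (x : M) :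
    MDiffAt (h.coordMetric x) x := by
  have := (h.contMDiff.contMDiffAt (x := x)).mdifferentiableAt (by simp)
  rw [mdifferentiableAt_section] at this
  refine this.congr_of_eventuallyEq ?_
  filter_upwards [(chartAt H x).open_source.mem_nhds (mem_chart_source H x)] with y hy
  ext v w
  rw [coordMetric_apply]
  simp [hom_trivializationAt_apply, ContinuousLinearMap.inCoordinates, hy, ofCoord]

lemma separatingLeft_coordMetric (h : SemiRiemannianMetric I M) (x : M) (v : E)
    (hv : ∀ w, h.coordMetric x x v w = 0) : v = 0 := by
  have : ofCoord (I := I) x x v = 0 := by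
    apply h.nondegenerate
    intro w
    have := hv (toCoord x x w)
    rwa [coordMetric_apply, ofCoord_toCoord (mem_chart_source H x)] at this
  rw [← toCoord_ofCoord (I := I) (mem_chart_source H x) v, this, map_zero]

variable [FiniteDimensional ℝ E]

/-- The isomorphism `v ↦ h(v, ·)` at `x`, in coordinates. -/
def coordFlat (h : SemiRiemannianMetric I M) (x : M) : E ≃L[ℝ] (E →L[ℝ] ℝ) :=
  LinearEquiv.toContinuousLinearEquiv <|
    LinearMap.linearEquivOfInjective (h.coordMetric x x).toLinearMap
      ((injective_iff_map_eq_zero _).2 fun v hv ↦ h.separatingLeft_coordMetric x v fun w ↦ by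
        simpa using congr($hv w))
      (by
        rw [← (LinearMap.toContinuousLinearMap (𝕜 := ℝ) (E := E) (F' := ℝ)).finrank_eq]
        exact Subspace.dual_finrank_eq.symm)

lemma coordFlat_apply (h : SemiRiemannianMetric I M) (x : M) (v w : E) :
    h.coordFlat x v w = h.coordMetric x x v w := rfl

/-- The partial derivative `∂_v h(w, z)` at `x` of the coordinate expression of the metric. -/
def coordMetricDeriv (h : SemiRiemannianMetric I M) (x : M) (v w z : E) : ℝ :=
  mvfderiv I (fun y ↦ h.coordMetric x y w z) x (ofCoord x x v)

lemma mdifferentiableAt_coordMetric_apply (h : SemiRiemannianMetric I M) (x : M) (w z : E) :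
    MDiffAt (fun y ↦ h.coordMetric x y w z) x :=
  ((h.mdifferentiableAt_coordMetric x).clm_apply mdifferentiableAt_const).clm_apply
    mdifferentiableAt_const

lemma coordMetric_comm (h : SemiRiemannianMetric I M) (x y : M) (w z : E) :
    h.coordMetric x y w z = h.coordMetric x y z w := h.symm y _ _

lemma coordMetricDeriv_comm (h : SemiRiemannianMetric I M) (x : M) (v w z : E) :
    h.coordMetricDeriv x v w z = h.coordMetricDeriv x v z w := by
  simp only [coordMetricDeriv, h.coordMetric_comm x _ w z]

lemma coordMetricDeriv_add₁ (h : SemiRiemannianMetric I M) (x : M) (v v' w z : E) :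
    h.coordMetricDeriv x (v + v') w z
      = h.coordMetricDeriv x v w z + h.coordMetricDeriv x v' w z := by
  simp only [coordMetricDeriv, map_add]

lemma coordMetricDeriv_smul₁ (h : SemiRiemannianMetric I M) (x : M) (c : ℝ) (v w z : E) :
    h.coordMetricDeriv x (c • v) w z = c * h.coordMetricDeriv x v w z := by
  simp only [coordMetricDeriv, map_smul, smul_eq_mul]

lemma coordMetricDeriv_add₃ (h : SemiRiemannianMetric I M) (x : M) (v w z z' : E) :
    h.coordMetricDeriv x v w (z + z')
      = h.coordMetricDeriv x v w z + h.coordMetricDeriv x v w z' := by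
  simp only [coordMetricDeriv, map_add]
  rw [mvfderiv_fun_add (h.mdifferentiableAt_coordMetric_apply x w z)
    (h.mdifferentiableAt_coordMetric_apply x w z')]
  rfl

lemma coordMetricDeriv_smul₃ (h : SemiRiemannianMetric I M) (x : M) (c : ℝ) (v w z : E) :
    h.coordMetricDeriv x v w (c • z) = c * h.coordMetricDeriv x v w z := by
  simp only [coordMetricDeriv, map_smul, smul_eq_mul]
  rw [mvfderiv_fun_mul mdifferentiableAt_const (h.mdifferentiableAt_coordMetric_apply x w z),
    mvfderiv_const]
  simp

lemma coordMetricDeriv_add₂ (h : SemiRiemannianMetric I M) (x : M) (v w w' z : E) :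
    h.coordMetricDeriv x v (w + w') z
      = h.coordMetricDeriv x v w z + h.coordMetricDeriv x v w' z := by
  simp only [coordMetricDeriv_comm h x v _ z, coordMetricDeriv_add₃]

lemma coordMetricDeriv_smul₂ (h : SemiRiemannianMetric I M) (x : M) (c : ℝ) (v w z : E) :
    h.coordMetricDeriv x v (c • w) z = c * h.coordMetricDeriv x v w z := by
  simp only [coordMetricDeriv_comm h x v _ z, coordMetricDeriv_smul₃]

/-- Christoffel symbols of the first kind,
`Γ(v, w; z) = (∂_v h(w, z) + ∂_w h(v, z) - ∂_z h(v, w)) / 2`. -/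
def christoffelLower (h : SemiRiemannianMetric I M) (x : M) (v w : E) : E →L[ℝ] ℝ :=
  LinearMap.toContinuousLinearMap
    { toFun z := (1 / 2) * (h.coordMetricDeriv x v w z
        + h.coordMetricDeriv x w v z - h.coordMetricDeriv x z v w)
      map_add' z z' := by simp only [coordMetricDeriv_add₁, coordMetricDeriv_add₃]; ring
      map_smul' c z := by
        simp only [coordMetricDeriv_smul₁, coordMetricDeriv_smul₃, smul_eq_mul,
          RingHom.id_apply]
        ring }

lemma christoffelLower_apply (h : SemiRiemannianMetric I M) (x : M) (v w z : E) :
    h.christoffelLower x v w z = (1 / 2) * (h.coordMetricDeriv x v w z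
      + h.coordMetricDeriv x w v z - h.coordMetricDeriv x z v w) := rfl

/-- Christoffel symbols of the second kind at `x`, in the preferred chart at `x`. -/
def christoffel (h : SemiRiemannianMetric I M) (x : M) : E →L[ℝ] E →L[ℝ] E :=
  LinearMap.toContinuousBilinearMap <|
    LinearMap.mk₂ ℝ (fun v w ↦ (h.coordFlat x).symm (h.christoffelLower x v w))
      (fun v v' w ↦ by
        rw [← map_add]; congr 1; ext z
        simp only [christoffelLower_apply, coordMetricDeriv_add₁, coordMetricDeriv_add₂,
          add_apply]
        ring)
      (fun c v w ↦ by
        rw [← map_smul]; congr 1; ext z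
        simp only [christoffelLower_apply, coordMetricDeriv_smul₁, coordMetricDeriv_smul₂,
          smul_apply, smul_eq_mul]
        ring)
      (fun v w w' ↦ by
        rw [← map_add]; congr 1; ext z
        simp only [christoffelLower_apply, coordMetricDeriv_add₁, coordMetricDeriv_add₂,
          coordMetricDeriv_add₃, add_apply]
        ring)
      (fun c v w ↦ by
        rw [← map_smul]; congr 1; ext z
        simp only [christoffelLower_apply, coordMetricDeriv_smul₁, coordMetricDeriv_smul₂,
          coordMetricDeriv_smul₃, smul_apply, smul_eq_mul]
        ring)

lemma coordMetric_christoffel (h : SemiRiemannianMetric I M) (x : M) (v w z : E) :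
    h.coordMetric x x (h.christoffel x v w) z = (1 / 2) * (h.coordMetricDeriv x v w z
      + h.coordMetricDeriv x w v z - h.coordMetricDeriv x z v w) := by
  rw [← coordFlat_apply, ← christoffelLower_apply]
  simp [christoffel]

lemma christoffel_comm (h : SemiRiemannianMetric I M) (x : M) (v w : E) :
    h.christoffel x v w = h.christoffel x w v := by
  apply (h.coordFlat x).injective
  ext z
  rw [coordFlat_apply, coordFlat_apply, coordMetric_christoffel,
    coordMetric_christoffel,
    coordMetricDeriv_comm h x z v w]
  ring

/-- The Levi-Civita connection, `∇_v Y = ∂_v Y + Γ(v, Y)` in coordinates. -/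
def leviCivita (h : SemiRiemannianMetric I M) :
    CovariantDerivative I E (TangentSpace I : M → Type _) where
  toFun Y x := ofCoord x x ∘L
    (mvfderiv I (fun y ↦ toCoord x y (Y y)) x
      + (h.christoffel x).flip (toCoord x x (Y x)) ∘L toCoord x x)
  isCovariantDerivativeOnUniv :=
    { add := by
        intro Y Y' x hY hY' _
        rw [mdifferentiableAt_toCoord] at hY hY'
        ext v
        simp [mvfderiv_fun_add hY hY']
        abel
      leibniz := by
        intro Y f x hY hf _
        rw [mdifferentiableAt_toCoord] at hY
        ext v
        simp [mvfderiv_fun_smul hf hY, ofCoord_toCoord (mem_chart_source H x)]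
        module }

lemma leviCivita_apply (h : SemiRiemannianMetric I M) (Y : Π x : M, TangentSpace I x) (x : M)
    (v : TangentSpace I x) : h.leviCivita Y x v = ofCoord x x
    (mvfderiv I (fun y ↦ toCoord x y (Y y)) x v
      + h.christoffel x (toCoord x x v) (toCoord x x (Y x))) := rfl

/-- The Levi-Civita connection is compatible with the metric. -/
lemma mvfderiv_metric (h : SemiRiemannianMetric I M) {Y Z : Π x : M, TangentSpace I x} {x : M}
    (hY : MDiffAt (T% Y) x) (hZ : MDiffAt (T% Z) x) (v : TangentSpace I x) :
    mvfderiv I (fun y ↦ h.val y (Y y) (Z y)) x v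
      = h.val x (h.leviCivita Y x v) (Z x) + h.val x (Y x) (h.leviCivita Z x v) := by
  have hY' := mdifferentiableAt_toCoord.1 hY
  have hZ' := mdifferentiableAt_toCoord.1 hZ
  have hG := h.mdifferentiableAt_coordMetric x
  have key : (fun y ↦ h.val y (Y y) (Z y)) =ᶠ[nhds x]
      fun y ↦ h.coordMetric x y (toCoord x y (Y y)) (toCoord x y (Z y)) := by
    filter_upwards [(chartAt H x).open_source.mem_nhds (mem_chart_source H x)] with y hy
    rw [coordMetric_apply, ofCoord_toCoord hy, ofCoord_toCoord hy]
  have hval (v w) : h.val x v w = h.coordMetric x x (toCoord x x v) (toCoord x x w) := by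
    rw [coordMetric_apply, ofCoord_toCoord (mem_chart_source H x),
      ofCoord_toCoord (mem_chart_source H x)]
  have hs := mem_chart_source H x
  have e1 : mvfderiv I (fun y ↦ h.val y (Y y) (Z y)) x v
      = h.coordMetricDeriv x (toCoord x x v) (toCoord x x (Y x)) (toCoord x x (Z x))
      + h.coordMetric x x (mvfderiv I (fun y ↦ toCoord x y (Y y)) x v) (toCoord x x (Z x))
      + h.coordMetric x x (toCoord x x (Y x)) (mvfderiv I (fun y ↦ toCoord x y (Z y)) x v) := by
    have hG1 := h.mdifferentiableAt_coordMetric_apply x (toCoord x x (Y x)) (toCoord x x (Z x))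
    have hu : UniqueDiffWithinAt ℝ (Set.range I) (extChartAt I x x) :=
      I.uniqueDiffOn _ (Set.mem_range_self _)
    have hmd := (hG.clm_apply hY').clm_apply hZ'
    have key' := key.mfderiv_eq (I := I) (I' := 𝓘(ℝ, ℝ))
    have : mvfderiv I (fun y ↦ h.val y (Y y) (Z y)) x v = mvfderiv I
        (fun y ↦ h.coordMetric x y (toCoord x y (Y y)) (toCoord x y (Z y))) x v := by
      have h1 := h.symm
      simp only [mvfderiv]
      erw [key']
      rfl
    rw [this]
    simp only [coordMetricDeriv, mvfderiv_eq_fderivWithin hmd, mvfderiv_eq_fderivWithin hG1,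
      mvfderiv_eq_fderivWithin hY', mvfderiv_eq_fderivWithin hZ', ofCoord_toCoord hs]
    have dG : DifferentiableWithinAt ℝ (h.coordMetric x ∘ (extChartAt I x).symm) (Set.range I)
      (extChartAt I x x) := hG.differentiableWithinAt_writtenInExtChartAt
    have dY : DifferentiableWithinAt ℝ ((fun y ↦ toCoord x y (Y y)) ∘ (extChartAt I x).symm)
      (Set.range I) (extChartAt I x x) := hY'.differentiableWithinAt_writtenInExtChartAt
    have dZ : DifferentiableWithinAt ℝ ((fun y ↦ toCoord x y (Z y)) ∘ (extChartAt I x).symm)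
      (Set.range I) (extChartAt I x x) := hZ'.differentiableWithinAt_writtenInExtChartAt
    exact fderivWithin_bilinear_apply hu dG dY dZ
      (congrArg (fun y ↦ h.coordMetric x y) (extChartAt_to_inv x))
      (congrArg (fun y ↦ toCoord x y (Y y)) (extChartAt_to_inv x))
      (congrArg (fun y ↦ toCoord x y (Z y)) (extChartAt_to_inv x)) v
  rw [e1, hval, hval, leviCivita_apply, leviCivita_apply, toCoord_ofCoord hs, toCoord_ofCoord hs,
    map_add, map_add, add_apply, coordMetric_christoffel,
    h.coordMetric_comm x x _ (h.christoffel x _ _), coordMetric_christoffel,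
    coordMetricDeriv_comm h x _ (toCoord x x (Z x)) (toCoord x x (Y x))]
  ring

lemma toCoord_eventuallyEq (x : M) (Z : Π x : M, TangentSpace I x) :
    (fun u ↦ toCoord x ((extChartAt I x).symm u) (Z ((extChartAt I x).symm u)))
      =ᶠ[nhdsWithin (extChartAt I x x) (Set.range I)]
    VectorField.mpullbackWithin 𝓘(ℝ, E) I (extChartAt I x).symm Z (Set.range I) := by
  filter_upwards [extChartAt_target_mem_nhdsWithin x] with u hu
  have hy : (extChartAt I x).symm u ∈ (chartAt H x).source := by
    simpa using (extChartAt I x).map_target hu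
  have h1 := TangentBundle.symmL_trivializationAt (I := I) hy
  rw [(extChartAt I x).right_inv hu] at h1
  rw [VectorField.mpullbackWithin_apply, ← h1]
  have h2 := ContinuousLinearMap.inverse_eq
    (f := (ofCoord x ((extChartAt I x).symm u) :
      E →L[ℝ] TangentSpace I ((extChartAt I x).symm u)))
    (g := toCoord x ((extChartAt I x).symm u))
    (ContinuousLinearMap.ext fun w ↦ ofCoord_toCoord hy w)
    (ContinuousLinearMap.ext fun w ↦ toCoord_ofCoord hy w)
  exact congr($h2.symm (Z ((extChartAt I x).symm u)))

lemma mvfderiv_toCoord {Z : Π x : M, TangentSpace I x} {x : M} (hZ : MDiffAt (T% Z) x)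
    (v : TangentSpace I x) :
    mvfderiv I (fun y ↦ toCoord x y (Z y)) x v = fderivWithin ℝ
     (VectorField.mpullbackWithin 𝓘(ℝ, E) I (extChartAt I x).symm Z (Set.range I)) (Set.range I)
     (extChartAt I x x) v := by
  rw [mdifferentiableAt_toCoord] at hZ
  rw [mvfderiv_eq_fderivWithin hZ]
  congr 1
  exact (toCoord_eventuallyEq x Z).fderivWithin_eq_of_mem (Set.mem_range_self _)

/-- The Levi-Civita connection is torsion-free. -/
lemma torsion_leviCivita (h : SemiRiemannianMetric I M)
    {Y Z : Π x : M, TangentSpace I x} {x : M}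
    (hY : MDiffAt (T% Y) x) (hZ : MDiffAt (T% Z) x) :
    h.leviCivita Z x (Y x) - h.leviCivita Y x (Z x) = VectorField.mlieBracket I Y Z x := by
  rw [leviCivita_apply, leviCivita_apply, christoffel_comm, ← map_sub, add_sub_add_right_eq_sub,
    mvfderiv_toCoord hY, mvfderiv_toCoord hZ]
  have hs := mem_chart_source H x
  have h0 := TangentBundle.continuousLinearMapAt_trivializationAt (I := I) hs
  have h2 := ContinuousLinearMap.inverse_eq
      (f := (toCoord x x : TangentSpace I x →L[ℝ] E)) (g := ofCoord x x)
      (ContinuousLinearMap.ext fun w ↦ toCoord_ofCoord hs w)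
      (ContinuousLinearMap.ext fun w ↦ ofCoord_toCoord hs w)
  have h3 (w : TangentSpace I x) : toCoord x x w = w := by
    have h5 : (toCoord x x : TangentSpace I x →L[ℝ] E) = mfderiv I 𝓘(ℝ, E) (extChartAt I x) x := h0
    rw [h5, mfderiv_extChartAt_self]
    rfl
  have h4 (W : Π x : M, TangentSpace I x) : VectorField.mpullbackWithin 𝓘(ℝ, E) I
      (extChartAt I x).symm W (Set.range I) (extChartAt I x x) = toCoord x x (W x) :=
    (toCoord_eventuallyEq x W).self_of_nhdsWithin (Set.mem_range_self _)
      |>.symm.trans (congrArg (fun y ↦ toCoord x y (W y)) (extChartAt_to_inv x))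
  rw [← VectorField.mlieBracketWithin_univ, VectorField.mlieBracketWithin_apply, ← h0]
  refine Eq.trans ?_ congr($h2.symm _)
  congr 1
  rw [Set.preimage_univ, Set.univ_inter]
  change _ = fderivWithin ℝ _ _ _ (VectorField.mpullbackWithin 𝓘(ℝ, E) I
      (extChartAt I x).symm Y (Set.range I) (extChartAt I x x)) -
      fderivWithin ℝ _ _ _ (VectorField.mpullbackWithin 𝓘(ℝ, E) I
      (extChartAt I x).symm Z (Set.range I) (extChartAt I x x))
  rw [h4 Y, h4 Z, h3, h3]
  rfl

end SemiRiemannianMetric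

namespace CovariantDerivative
variable [FiniteDimensional ℝ E]

lemma tensorialAt_endomorphism (cov : CovariantDerivative I E (TangentSpace I : M → Type _))
    (A : Π x : M, TangentSpace I x →L[ℝ] TangentSpace I x) (x : M)
    (hA : MDifferentiableAt I (I.prod 𝓘(ℝ, E →L[ℝ] E))
      (fun y ↦ Bundle.TotalSpace.mk' (E →L[ℝ] E) y (A y)) x) :
    TensorialAt I E (fun Y ↦ cov (fun y ↦ A y (Y y)) x - A x ∘L cov Y x) x where
  smul := by
    intro f Y hf hY
    have hAY : MDiffAt (T% (fun y ↦ A y (Y y))) x := hA.clm_bundle_apply hY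
    have h1 := cov.isCovariantDerivativeOn.leibniz (x := x) hAY hf
    have h2 := cov.isCovariantDerivativeOn.leibniz (x := x) hY hf
    have h3 : (fun y ↦ A y ((f • Y) y)) = f • (fun y ↦ A y (Y y)) := by
      ext y; simp
    rw [h3, h1, h2]
    ext v
    simp
    module
  add := by
    intro Y Y' hY hY'
    have hAY : MDiffAt (T% (fun y ↦ A y (Y y))) x := hA.clm_bundle_apply hY
    have hAY' : MDiffAt (T% (fun y ↦ A y (Y' y))) x := hA.clm_bundle_apply hY'
    have h1 := cov.isCovariantDerivativeOn.add (x := x) hAY hAY'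
    have h2 := cov.isCovariantDerivativeOn.add (x := x) hY hY'
    have h3 : (fun y ↦ A y ((Y + Y') y)) = (fun y ↦ A y (Y y)) + (fun y ↦ A y (Y' y)) := by
      ext y; simp
    rw [h3, h1, h2]
    ext v
    simp
    module
end CovariantDerivative

section Map

variable {E' : Type*} [NormedAddCommGroup E'] [NormedSpace ℝ E']
  {H' : Type*} [TopologicalSpace H'] {J : ModelWithCorners ℝ E' H'}
  {N : Type*} [TopologicalSpace N] [ChartedSpace H' N] [IsManifold J ∞ N]

lemma mdifferentiableAt_toCoord_along {F : M → N} {x : M} {V : Π y : M, TangentSpace J (F y)}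
    (hV : MDifferentiableAt I J.tangent (fun y ↦ (⟨F y, V y⟩ : TangentBundle J N)) x) :
    MDiffAt (fun y ↦ toCoord (F x) (F y) (V y)) x := by
  rw [mdifferentiableAt_totalSpace] at hV
  refine hV.2.congr_of_eventuallyEq ?_
  filter_upwards [hV.1.continuousAt.preimage_mem_nhds
    ((chartAt H' (F x)).open_source.mem_nhds (mem_chart_source H' (F x)))] with y hy
  simp only [toCoord]
  rw [Bundle.Trivialization.continuousLinearMapAt_apply,
    Bundle.Trivialization.linearMapAt_apply, if_pos]
  simpa using hy

variable [FiniteDimensional ℝ E']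

/-- The pull-back of the Levi-Civita connection of `g` along `F`, differentiating vector fields `V`
along `F`: `∇_v V = ∂_v V + Γ(F_* v, V)` in coordinates. -/
def SemiRiemannianMetric.covAlong (g : SemiRiemannianMetric J N) (F : M → N)
    (V : Π y : M, TangentSpace J (F y)) (x : M) : TangentSpace I x →L[ℝ] TangentSpace J (F x) :=
  ofCoord (F x) (F x) ∘L
    (mvfderiv I (fun y ↦ toCoord (F x) (F y) (V y)) x
      + (g.christoffel (F x)).flip (toCoord (F x) (F x) (V x)) ∘L
        toCoord (F x) (F x) ∘L mfderiv I J F x)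

/-- The pull-back connection satisfies `∇_v (Z ∘ F) = ∇_{F_* v} Z`. -/
lemma SemiRiemannianMetric.covAlong_comp (g : SemiRiemannianMetric J N) {F : M → N} {x : M}
    (hF : MDifferentiableAt I J F x) {Z : Π y : N, TangentSpace J y}
    (hZ : MDiffAt (T% Z) (F x)) :
    g.covAlong (I := I) F (fun y ↦ Z (F y)) x = g.leviCivita Z (F x) ∘L mfderiv I J F x := by
  rw [mdifferentiableAt_toCoord] at hZ
  have := mfderiv_comp x hZ hF
  ext v
  simp only [covAlong, leviCivita_apply, ContinuousLinearMap.comp_apply, add_apply]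
  congr 2
  exact congr($this v)

lemma SemiRiemannianMetric.covAlong_add (g : SemiRiemannianMetric J N) {F : M → N} {x : M}
    {V V' : Π y : M, TangentSpace J (F y)}
    (hV : MDiffAt (fun y ↦ toCoord (F x) (F y) (V y)) x)
    (hV' : MDiffAt (fun y ↦ toCoord (F x) (F y) (V' y)) x) :
    g.covAlong (I := I) F (V + V') x = g.covAlong F V x + g.covAlong F V' x := by
  ext v
  simp [covAlong, mvfderiv_fun_add hV hV']
  abel

lemma SemiRiemannianMetric.covAlong_smul (g : SemiRiemannianMetric J N) {F : M → N} {x : M}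
    {f : M → ℝ} {V : Π y : M, TangentSpace J (F y)} (hf : MDiffAt f x)
    (hV : MDiffAt (fun y ↦ toCoord (F x) (F y) (V y)) x) :
    g.covAlong (I := I) F (f • V) x
      = f x • g.covAlong F V x + (mvfderiv I f x).smulRight (V x) := by
  ext v
  simp [covAlong, mvfderiv_fun_smul hf hV, ofCoord_toCoord (mem_chart_source H' (F x))]
  module

lemma tensorialAt_secondFundamentalForm (h : SemiRiemannianMetric I M)
    (g : SemiRiemannianMetric J N)
    {F : M → N} (hF : ContMDiff I J ∞ F) (x : M) [FiniteDimensional ℝ E] :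
    TensorialAt I E (fun Y : Π y : M, TangentSpace I y ↦
      g.covAlong (I := I) F (fun y ↦ mfderiv I J F y (Y y)) x
        - mfderiv I J F x ∘L h.leviCivita Y x) x := by
  have aux (Y : Π y : M, TangentSpace I y) (hY : MDiffAt (T% Y) x) :
      MDiffAt (fun y ↦ toCoord (F x) (F y) (mfderiv I J F y (Y y))) x := by
    apply mdifferentiableAt_toCoord_along
    have h1 : ContMDiff I.tangent J.tangent 1 (tangentMap I J F) :=
      hF.contMDiff_tangentMap (by norm_num; exact ENat.LEInfty.out)
    exact (h1.mdifferentiable one_ne_zero _).comp x hY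
  constructor
  · intro f Y hf hY
    have h1 : g.covAlong (I := I) F (fun y ↦ mfderiv I J F y ((f • Y) y)) x
        = g.covAlong (I := I) F (f • fun y ↦ mfderiv I J F y (Y y)) x := by
      congr 1; ext y; simp
    rw [h1, g.covAlong_smul hf (aux Y hY), h.leviCivita.isCovariantDerivativeOn.leibniz hY hf]
    ext v
    simp
    module
  · intro Y Y' hY hY'
    have h1 : g.covAlong (I := I) F (fun y ↦ mfderiv I J F y ((Y + Y') y)) x
        = g.covAlong (I := I) F
          ((fun y ↦ mfderiv I J F y (Y y)) + fun y ↦ mfderiv I J F y (Y' y)) x := by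
      congr 1; ext y; simp
    rw [h1, g.covAlong_add (aux Y hY) (aux Y' hY'),
      h.leviCivita.isCovariantDerivativeOn.add hY hY']
    ext v
    simp
    module


end Map

section Trace

variable {V W : Type*} [AddCommGroup V] [Module ℝ V] [AddCommGroup W] [Module ℝ W]

/-- The contraction `∑ᵢⱼ hⁱʲ B(bᵢ, bⱼ)`, where `(hⁱʲ)` is the inverse of the matrix
`h(bᵢ, bⱼ)`. -/
def gramTrace {ι : Type*} [Fintype ι] [DecidableEq ι] (b : Basis ι ℝ V) (h : V → V → ℝ)
    (B : V → V → W) : W :=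
  ∑ i, ∑ j, (Matrix.of fun k l ↦ h (b k) (b l))⁻¹ i j • B (b i) (b j)

lemma gramTrace_reindex {ι κ : Type*} [Fintype ι] [DecidableEq ι] [Fintype κ] [DecidableEq κ]
    (b : Basis ι ℝ V) (h : V → V → ℝ) (B : V → V → W) (e : ι ≃ κ) :
    gramTrace (b.reindex e) h B = gramTrace b h B := by
  have h1 : (Matrix.of fun k l ↦ h (b.reindex e k) (b.reindex e l))
      = (Matrix.of fun k l ↦ h (b k) (b l)).submatrix e.symm e.symm := by
    ext; simp
  simp only [gramTrace, h1, Matrix.inv_submatrix_equiv]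
  rw [← Equiv.sum_comp e]
  refine Finset.sum_congr rfl fun i _ ↦ ?_
  rw [← Equiv.sum_comp e]
  simp

lemma gramTrace_eq {ι κ : Type*} [Fintype ι] [DecidableEq ι] [Fintype κ] [DecidableEq κ]
    (b : Basis ι ℝ V) (b' : Basis κ ℝ V) (h : V →ₗ[ℝ] V →ₗ[ℝ] ℝ) (B : V →ₗ[ℝ] V →ₗ[ℝ] W) :
    gramTrace b (fun v w ↦ h v w) (fun v w ↦ B v w)
      = gramTrace b' (fun v w ↦ h v w) (fun v w ↦ B v w) := by
  rw [← gramTrace_reindex b' _ _ (b'.indexEquiv b)]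
  generalize b'.reindex (b'.indexEquiv b) = c
  set A : Matrix ι ι ℝ := b.toMatrix c with hA
  set G : Matrix ι ι ℝ := Matrix.of fun k l ↦ h (b k) (b l) with hG
  have hc (i : ι) : c i = ∑ k, A k i • b k := (b.sum_toMatrix_smul_self c i).symm
  have hu : A * c.toMatrix b = 1 := by simp [hA]
  have hdet : IsUnit A.det := by
    have := congrArg Matrix.det hu
    rw [Matrix.det_mul, Matrix.det_one] at this
    exact IsUnit.of_mul_eq_one _ this
  have hG' : (Matrix.of fun k l ↦ h (c k) (c l)) = A.transpose * G * A := by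
    ext i j
    simp only [Matrix.of_apply, hc, map_sum, map_smul, LinearMap.sum_apply, LinearMap.smul_apply,
      Matrix.mul_apply, hG, Matrix.transpose_apply, smul_eq_mul, Finset.sum_mul, Finset.mul_sum]
    exact Finset.sum_congr rfl fun _ _ ↦ Finset.sum_congr rfl fun _ _ ↦ by ring
  have hinv : A * (A.transpose * G * A)⁻¹ * A.transpose = G⁻¹ := by
    rw [Matrix.mul_inv_rev, Matrix.mul_inv_rev, ← Matrix.mul_assoc, Matrix.mul_nonsing_inv _ hdet,
      Matrix.one_mul, Matrix.mul_assoc, Matrix.nonsing_inv_mul _ (by simpa using hdet),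
      Matrix.mul_one]
  simp only [gramTrace]
  rw [hG', ← hinv]
  set K := (A.transpose * G * A)⁻¹
  have hL (k l : ι) : (A * K * A.transpose) k l = ∑ i, ∑ j, A k i * K i j * A l j := by
    simp only [Matrix.mul_apply, Matrix.transpose_apply, Finset.sum_mul]
    exact Finset.sum_comm
  have hR (i j : ι) : B (c i) (c j) = ∑ k, ∑ l, (A k i * A l j) • B (b k) (b l) := by
    simp only [hc, map_sum, map_smul, LinearMap.sum_apply, LinearMap.smul_apply, Finset.smul_sum,
      smul_smul]
    rw [Finset.sum_comm]
    simp only [mul_comm]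
  have hcomm (f : ι → ι → ι → ι → W) :
      ∑ k, ∑ l, ∑ i, ∑ j, f k l i j = ∑ i, ∑ j, ∑ k, ∑ l, f k l i j := by
    have h3 (f : ι → ι → ι → W) : ∑ l, ∑ i, ∑ j, f l i j = ∑ i, ∑ j, ∑ l, f l i j :=
      Finset.sum_comm.trans (Finset.sum_congr rfl fun i _ ↦ Finset.sum_comm)
    exact (Finset.sum_congr rfl fun k _ ↦ h3 (f k)).trans (h3 fun k i j ↦ ∑ l, f k l i j)
  simp only [hL, hR, Finset.sum_smul, Finset.smul_sum, smul_smul]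
  rw [hcomm]
  refine Finset.sum_congr rfl fun i _ ↦ Finset.sum_congr rfl fun j _ ↦
    Finset.sum_congr rfl fun k _ ↦ Finset.sum_congr rfl fun l _ ↦ ?_
  congr 1
  ring

/-- In an orthonormal basis the contraction is `∑ᵢ h(eᵢ, eᵢ) B(eᵢ, eᵢ)`. -/
lemma gramTrace_orthonormal {ι κ : Type*} [Fintype ι] [DecidableEq ι] [Fintype κ] [DecidableEq κ]
    (b : Basis ι ℝ V) (c : Basis κ ℝ V) (h : V →ₗ[ℝ] V →ₗ[ℝ] ℝ) (B : V →ₗ[ℝ] V →ₗ[ℝ] W)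
    (h₀ : ∀ i j, i ≠ j → h (c i) (c j) = 0) (h₁ : ∀ i, h (c i) (c i) = 1 ∨ h (c i) (c i) = -1) :
    gramTrace b (fun v w ↦ h v w) (fun v w ↦ B v w)
      = ∑ i, h (c i) (c i) • B (c i) (c i) := by
  rw [gramTrace_eq b c]
  have hG : (Matrix.of fun k l ↦ h (c k) (c l)) = Matrix.diagonal fun i ↦ h (c i) (c i) := by
    ext i j
    by_cases hij : i = j
    · subst hij; simp
    · simp [hij, h₀ i j hij]
  have hG' : (Matrix.of fun k l ↦ h (c k) (c l))⁻¹ = Matrix.diagonal fun i ↦ h (c i) (c i) := by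
    rw [hG]
    apply Matrix.inv_eq_right_inv
    rw [Matrix.diagonal_mul_diagonal, ← Matrix.diagonal_one]
    congr 1
    ext i
    rcases h₁ i with hi | hi <;> simp [hi]
  simp [gramTrace, hG', Matrix.diagonal_apply]

end Trace

section Structures

variable (I M) in
/-- A smooth `(1,1)`-tensor field `P` with `P² = I`. -/
structure AlmostProductStructure where
  val (x : M) : TangentSpace I x →L[ℝ] TangentSpace I x
  val_val (x : M) (v : TangentSpace I x) : val x (val x v) = v
  contMDiff : ContMDiff I (I.prod 𝓘(ℝ, E →L[ℝ] E)) ∞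
    (fun x ↦ Bundle.TotalSpace.mk' (E →L[ℝ] E) x (val x))

/-- `(M, h, P)` is an almost para-Hermitian manifold: `h(P v, w) = -h(v, P w)`. -/
def IsAlmostParaHermitian (h : SemiRiemannianMetric I M) (P : AlmostProductStructure I M) : Prop :=
  ∀ (x : M) (v w : TangentSpace I x), h.val x (P.val x v) w = -h.val x v (P.val x w)

/-- `(M, h, P)` is an almost product Riemannian manifold: `h` is positive definite and
`h(P v, w) = h(v, P w)`. -/
def IsAlmostProductRiemannian (h : SemiRiemannianMetric I M) (P : AlmostProductStructure I M) :
    Prop :=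
  (∀ (x : M) (v : TangentSpace I x), v ≠ 0 → 0 < h.val x v v) ∧
    ∀ (x : M) (v w : TangentSpace I x), h.val x (P.val x v) w = h.val x v (P.val x w)

/-- The vector fields `s i` form a smooth local frame on `U` which is orthonormal for `h`,
that is `h(sᵢ, sⱼ) = ± δᵢⱼ`. -/
structure IsOrthonormalFrameOn (h : SemiRiemannianMetric I M) {ι : Type*}
    (s : ι → Π x : M, TangentSpace I x) (U : Set M) : Prop where
  isLocalFrameOn : IsLocalFrameOn I E ∞ s U
  orthogonal : ∀ x ∈ U, ∀ i j, i ≠ j → h.val x (s i x) (s j x) = 0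
  normalized : ∀ x ∈ U, ∀ i, h.val x (s i x) (s i x) = 1 ∨ h.val x (s i x) (s i x) = -1

variable [FiniteDimensional ℝ E]

/-- The contraction `∑ᵢⱼ hⁱʲ B(bᵢ, bⱼ)` over a basis of the tangent space at `x`. -/
def SemiRiemannianMetric.trace (h : SemiRiemannianMetric I M) (x : M) {W : Type*}
    [AddCommGroup W] [Module ℝ W] (B : TangentSpace I x → TangentSpace I x → W) : W :=
  gramTrace (V := TangentSpace I x) (finBasis ℝ E) (fun v w ↦ h.val x v w) B

/-- The covariant derivative `(∇_v P) w` of the tensor field `P` for the Levi-Civita connection of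
`h`; for every differentiable vector field `Y` it is `(∇_v P)(Y x) = ∇_v (P Y) - P (∇_v Y)`. -/
def AlmostProductStructure.nabla (P : AlmostProductStructure I M) (h : SemiRiemannianMetric I M)
    (x : M) (v w : TangentSpace I x) : TangentSpace I x :=
  TensorialAt.mkHom (fun Y : Π y : M, TangentSpace I y ↦
    h.leviCivita (fun y ↦ P.val y (Y y)) x - P.val x ∘L h.leviCivita Y x) x
    (h.leviCivita.tensorialAt_endomorphism P.val x (P.contMDiff.mdifferentiable (by simp) x)) w v

lemma AlmostProductStructure.nabla_apply (P : AlmostProductStructure I M)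
    (h : SemiRiemannianMetric I M) {x : M} (v : TangentSpace I x) {Y : Π y : M, TangentSpace I y}
    (hY : MDiffAt (T% Y) x) :
    P.nabla h x v (Y x)
      = h.leviCivita (fun y ↦ P.val y (Y y)) x v - P.val x (h.leviCivita Y x v) :=
  congr($(TensorialAt.mkHom_apply (h.leviCivita.tensorialAt_endomorphism P.val x
    (P.contMDiff.mdifferentiable (by simp) x)) hY) v)

/-- `S_P(v, w) = (∇_v P) w + P ((∇_{P v} P) w)`. -/
def AlmostProductStructure.sTensor (P : AlmostProductStructure I M) (h : SemiRiemannianMetric I M)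
    (x : M) (v w : TangentSpace I x) : TangentSpace I x :=
  P.nabla h x v w + P.val x (P.nabla h x (P.val x v) w)

/-- The vector field `div P`, the contraction of `(v, w) ↦ (∇_v P) w` with the metric. -/
def AlmostProductStructure.div (P : AlmostProductStructure I M) (h : SemiRiemannianMetric I M)
    (x : M) : TangentSpace I x :=
  h.trace x (P.nabla h x)

lemma AlmostProductStructure.nabla_eq_linear (P : AlmostProductStructure I M)
    (h : SemiRiemannianMetric I M) (x : M) : ∃ B : TangentSpace I x →ₗ[ℝ] TangentSpace I x →ₗ[ℝ]
      TangentSpace I x, P.nabla h x = fun v w ↦ B v w :=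
  ⟨LinearMap.mk₂ ℝ (P.nabla h x) (by simp [nabla]) (by simp [nabla]) (by simp [nabla])
    (by simp [nabla]), rfl⟩

/-- In a local orthonormal frame, `div P = ∑ₐ h(sₐ, sₐ) (∇_{sₐ} P) sₐ`. -/
lemma AlmostProductStructure.div_eq_sum (P : AlmostProductStructure I M)
    (h : SemiRiemannianMetric I M) {ι : Type*} [Fintype ι] {s : ι → Π x : M, TangentSpace I x}
    {U : Set M} (hs : IsOrthonormalFrameOn h s U) {x : M} (hx : x ∈ U) :
    P.div h x = ∑ a, h.val x (s a x) (s a x) • P.nabla h x (s a x) (s a x) := by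
  classical
  obtain ⟨B, hB⟩ := P.nabla_eq_linear h x
  rw [div, hB]
  obtain ⟨L, hL⟩ : ∃ L : TangentSpace I x →ₗ[ℝ] TangentSpace I x →ₗ[ℝ] ℝ,
      ∀ v w, h.val x v w = L v w :=
    ⟨LinearMap.mk₂ ℝ (fun v w ↦ h.val x v w) (by simp)
      (fun c v w ↦ congr($(map_smul (h.val x) c v) w)) (by simp)
      (fun c v w ↦ map_smul (h.val x v) c w), fun v w ↦ rfl⟩
  have h₀ := hs.orthogonal x hx
  have h₁ := hs.normalized x hx
  simp only [SemiRiemannianMetric.trace, hL] at h₀ h₁ ⊢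
  obtain ⟨c, hc⟩ : ∃ c : Basis ι ℝ (TangentSpace I x), ∀ i, c i = s i x :=
    ⟨hs.isLocalFrameOn.toBasisAt hx, fun i ↦ hs.isLocalFrameOn.toBasisAt_coe hx i⟩
  simp only [← hc] at h₀ h₁ ⊢
  exact gramTrace_orthonormal (V := TangentSpace I x) (finBasis ℝ E) c L B h₀ h₁

end Structures

section Map

variable {E' : Type*} [NormedAddCommGroup E'] [NormedSpace ℝ E']
  {H' : Type*} [TopologicalSpace H'] {J : ModelWithCorners ℝ E' H'}
  {N : Type*} [TopologicalSpace N] [ChartedSpace H' N] [IsManifold J ∞ N]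

/-- `F_* P = Q F_*`. -/
def IsParaholomorphic (P : AlmostProductStructure I M) (Q : AlmostProductStructure J N)
    (F : M → N) : Prop :=
  ∀ (x : M) (v : TangentSpace I x),
    mfderiv I J F x (P.val x v) = Q.val (F x) (mfderiv I J F x v)

/-- `F_* P = -Q F_*`. -/
def IsAntiParaholomorphic (P : AlmostProductStructure I M) (Q : AlmostProductStructure J N)
    (F : M → N) : Prop :=
  ∀ (x : M) (v : TangentSpace I x),
    mfderiv I J F x (P.val x v) = -Q.val (F x) (mfderiv I J F x v)

variable [FiniteDimensional ℝ E] [FiniteDimensional ℝ E']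

/-- The second fundamental form `(∇F_*)(v, w)`; for every differentiable vector field `Y` it is
`(∇F_*)(v, Y x) = ∇^F_v (F_* Y) - F_* (∇_v Y)`, where `∇^F` is the pull-back of the Levi-Civita
connection of the target. -/
def secondFundamentalForm (h : SemiRiemannianMetric I M) (g : SemiRiemannianMetric J N)
    {F : M → N} (hF : ContMDiff I J ∞ F) (x : M) (v w : TangentSpace I x) :
    TangentSpace J (F x) :=
  TensorialAt.mkHom (fun Y : Π y : M, TangentSpace I y ↦
    g.covAlong (I := I) F (fun y ↦ mfderiv I J F y (Y y)) x
      - mfderiv I J F x ∘L h.leviCivita Y x) x (tensorialAt_secondFundamentalForm h g hF x) w v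

lemma secondFundamentalForm_apply (h : SemiRiemannianMetric I M) (g : SemiRiemannianMetric J N)
    {F : M → N} (hF : ContMDiff I J ∞ F) {x : M} (v : TangentSpace I x)
    {Y : Π y : M, TangentSpace I y} (hY : MDiffAt (T% Y) x) :
    secondFundamentalForm h g hF x v (Y x)
      = g.covAlong F (fun y ↦ mfderiv I J F y (Y y)) x v - mfderiv I J F x (h.leviCivita Y x v) :=
  congr($(TensorialAt.mkHom_apply (tensorialAt_secondFundamentalForm h g hF x) hY) v)

/-- The tension field `τ(F) = ∑ᵢⱼ hⁱʲ (∇F_*)(bᵢ, bⱼ)`. -/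
def tensionField (h : SemiRiemannianMetric I M) (g : SemiRiemannianMetric J N)
    {F : M → N} (hF : ContMDiff I J ∞ F) (x : M) : TangentSpace J (F x) :=
  h.trace x (secondFundamentalForm h g hF x)

end Map

end Geometry

end

/-! Write B for the second fundamental form and v' = F_* v. Both cases say F_* P = λ Q F_* with λ² =
1. Differentiating this along M (`secondFundamentalForm_val`) gives B(v, Pw) + F_*((∇_v P)w) =
λ((∇_{v'} Q)w' + Q B(v, w)).

Take w = v and apply λQ: this expresses B(v, v) through λQ B(v, Pv). Replace v by Pv and take w = v:
this expresses B(Pv, Pv) through λQ B(Pv, v). Since B is symmetric (`secondFundamentalForm_comm`),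
the mixed terms cancel in the difference. The two derivatives of Q combine to -Q S_Q(v', v'). The
identity P(∇_v P) = -(∇_v P)P (`AlmostProductStructure.val_nabla`) brings the derivatives of P into
the form λQ F_*((∇_v P)v - (∇_{Pv} P)Pv). This is `secondFundamentalForm_sub_val`.

In the frame (e_i, Pe_i) compatibility gives h(Pe_i, Pe_i) = -h(e_i, e_i), so both τ(F) and div P
are sums of differences of exactly these shapes, and summing over i proves the formula. Symmetry of
B and the Leibniz rule along F are checked in charts, using extensions with constant coordinates. -/

set_option linter.unusedSectionVars false

/-! ### Constant-coordinate fields and derivatives in a chart -/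

section LocalFields

variable {E : Type*} [NormedAddCommGroup E] [NormedSpace ℝ E]
  {H : Type*} [TopologicalSpace H] {I : ModelWithCorners ℝ E H}
  {M : Type*} [TopologicalSpace M] [ChartedSpace H M] [IsManifold I ∞ M]

/-- A vector field through `v` with constant coordinates in the preferred chart at `x`. -/
noncomputable def constField (x : M) (v : TangentSpace I x) (y : M) : TangentSpace I y :=
  ofCoord x y (toCoord x x v)

lemma constField_self (x : M) (v : TangentSpace I x) : constField x v x = v :=
  ofCoord_toCoord (mem_chart_source H x) v

/-- Kills the partial-derivative term in a covariant derivative of `constField` at `x`, leaving only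
the Christoffel term. -/
lemma toCoord_constField_eventuallyEq (x : M) (v : TangentSpace I x) :
    (fun y ↦ toCoord x y (constField x v y)) =ᶠ[nhds x] fun _ ↦ toCoord x x v := by
  filter_upwards [(chartAt H x).open_source.mem_nhds (mem_chart_source H x)] with y hy
  exact toCoord_ofCoord hy _

lemma mdifferentiableAt_constField (x : M) (v : TangentSpace I x) :
    MDiffAt (T% (constField (I := I) x v)) x :=
  mdifferentiableAt_toCoord.2 <|
    mdifferentiableAt_const.congr_of_eventuallyEq (toCoord_constField_eventuallyEq x v)

lemma Filter.EventuallyEq.mvfderiv_eq {W : Type*} [NormedAddCommGroup W] [NormedSpace ℝ W]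
    {f f' : M → W} {x : M} (hf : f =ᶠ[nhds x] f') (v : TangentSpace I x) :
    mvfderiv I f x v = mvfderiv I f' x v := by
  have h1 := hf.mfderiv_eq (I := I) (I' := 𝓘(ℝ, W))
  simp only [mvfderiv]
  erw [h1]
  rfl

/-- Product rule with the argument frozen at `c x` in the first term. That frozen term is the
derivative of the coefficients of a tensor on a constant-coordinate field, as it occurs in `nabla`.
-/
lemma mvfderiv_clm_apply {W W' : Type*} [NormedAddCommGroup W] [NormedSpace ℝ W]
    [NormedAddCommGroup W'] [NormedSpace ℝ W'] {A : M → W →L[ℝ] W'} {c : M → W} {x : M}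
    (hA : MDiffAt A x) (hc : MDiffAt c x) (v : TangentSpace I x) :
    mvfderiv I (fun y ↦ A y (c y)) x v
      = mvfderiv I (fun y ↦ A y (c x)) x v + A x (mvfderiv I c x v) := by
  have hu : UniqueDiffWithinAt ℝ (Set.range I) (extChartAt I x x) :=
    I.uniqueDiffOn _ (Set.mem_range_self _)
  have hA0 : MDiffAt (fun y ↦ A y (c x)) x := hA.clm_apply mdifferentiableAt_const
  rw [mvfderiv_eq_fderivWithin (hA.clm_apply hc), mvfderiv_eq_fderivWithin hA0,
    mvfderiv_eq_fderivWithin hc]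
  have dA : DifferentiableWithinAt ℝ (A ∘ (extChartAt I x).symm) (Set.range I)
    (extChartAt I x x) := hA.differentiableWithinAt_writtenInExtChartAt
  have dc : DifferentiableWithinAt ℝ (c ∘ (extChartAt I x).symm) (Set.range I)
    (extChartAt I x x) := hc.differentiableWithinAt_writtenInExtChartAt
  have h1 := fderivWithin_clm_apply hu dA dc
  have h2 := fderivWithin_clm_apply hu dA
    (differentiableWithinAt_const (c := c x) (s := Set.range I) (x := extChartAt I x x))
  have e1 : c ((extChartAt I x).symm (extChartAt I x x)) = c x :=
    congrArg c (extChartAt_to_inv x)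
  have e2 : A ((extChartAt I x).symm (extChartAt I x x)) = A x :=
    congrArg A (extChartAt_to_inv x)
  have h1' := congr($h1 v)
  have h2' := congr($h2 v)
  simp only [Function.comp_apply, e1, e2] at h1' h2'
  refine h1'.trans ?_
  erw [h2']
  simp
  exact add_comm _ _

end LocalFields

/-! ### Traces in orthonormal frames; ∇P anticommutes with P -/

section Trace

variable {E : Type*} [NormedAddCommGroup E] [NormedSpace ℝ E] [FiniteDimensional ℝ E]
  {H : Type*} [TopologicalSpace H] {I : ModelWithCorners ℝ E H}
  {M : Type*} [TopologicalSpace M] [ChartedSpace H M] [IsManifold I ∞ M]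

/-- In a local orthonormal frame, the trace of a bilinear map `B` is `∑ₐ h(sₐ, sₐ) B(sₐ, sₐ)`. -/
lemma IsOrthonormalFrameOn.trace_eq_sum {h : SemiRiemannianMetric I M} {ι : Type*} [Fintype ι]
    {s : ι → Π x : M, TangentSpace I x} {U : Set M} (hs : IsOrthonormalFrameOn h s U) {x : M}
    (hx : x ∈ U) {W : Type*} [AddCommGroup W] [Module ℝ W]
    (B : TangentSpace I x →ₗ[ℝ] TangentSpace I x →ₗ[ℝ] W) :
    h.trace x (fun v w ↦ B v w) = ∑ a, h.val x (s a x) (s a x) • B (s a x) (s a x) := by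
  classical
  obtain ⟨L, hL⟩ : ∃ L : TangentSpace I x →ₗ[ℝ] TangentSpace I x →ₗ[ℝ] ℝ,
      ∀ v w, h.val x v w = L v w :=
    ⟨LinearMap.mk₂ ℝ (fun v w ↦ h.val x v w) (by simp)
      (fun c v w ↦ congr($(map_smul (h.val x) c v) w)) (by simp)
      (fun c v w ↦ map_smul (h.val x v) c w), fun v w ↦ rfl⟩
  have h₀ := hs.orthogonal x hx
  have h₁ := hs.normalized x hx
  simp only [SemiRiemannianMetric.trace, hL] at h₀ h₁ ⊢
  obtain ⟨c, hc⟩ : ∃ c : Basis ι ℝ (TangentSpace I x), ∀ i, c i = s i x :=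
    ⟨hs.isLocalFrameOn.toBasisAt hx, fun i ↦ hs.isLocalFrameOn.toBasisAt_coe hx i⟩
  simp only [← hc] at h₀ h₁ ⊢
  exact gramTrace_orthonormal (V := TangentSpace I x) (finBasis ℝ E) c L B h₀ h₁

/-- The derivative of P² = Id: expand ∇P on an extension Y of `w` and on PY, and use P(PY) = Y. -/
lemma AlmostProductStructure.val_nabla (P : AlmostProductStructure I M)
    (h : SemiRiemannianMetric I M) (x : M) (v w : TangentSpace I x) :
    P.val x (P.nabla h x v w) = -P.nabla h x v (P.val x w) := by
  have hY := mdifferentiableAt_constField x w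
  have hPY : MDiffAt (T% (fun y ↦ P.val y (constField x w y))) x :=
    (P.contMDiff.mdifferentiable (by simp) x).clm_bundle_apply hY
  have h1 := P.nabla_apply h v hY
  have h2 := P.nabla_apply h v hPY
  simp only [P.val_val, constField_self] at h1 h2
  rw [h1, h2, map_sub, P.val_val]
  exact (neg_sub _ _).symm

end Trace

/-! ### The pull-back connection and its Leibniz rule -/

section Map

variable {E : Type*} [NormedAddCommGroup E] [NormedSpace ℝ E] [FiniteDimensional ℝ E]
  {H : Type*} [TopologicalSpace H] {I : ModelWithCorners ℝ E H}
  {M : Type*} [TopologicalSpace M] [ChartedSpace H M] [IsManifold I ∞ M]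
  {E' : Type*} [NormedAddCommGroup E'] [NormedSpace ℝ E'] [FiniteDimensional ℝ E']
  {H' : Type*} [TopologicalSpace H'] {J : ModelWithCorners ℝ E' H'}
  {N : Type*} [TopologicalSpace N] [ChartedSpace H' N] [IsManifold J ∞ N]

lemma mdifferentiableAt_pushforward {F : M → N} (hF : ContMDiff I J ∞ F) {x : M}
    {Y : Π y : M, TangentSpace I y} (hY : MDiffAt (T% Y) x) :
    MDiffAt (fun y ↦ toCoord (F x) (F y) (mfderiv I J F y (Y y))) x := by
  apply mdifferentiableAt_toCoord_along
  have h1 : ContMDiff I.tangent J.tangent 1 (tangentMap I J F) :=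
    hF.contMDiff_tangentMap (by norm_num; exact ENat.LEInfty.out)
  exact (h1.mdifferentiable one_ne_zero _).comp x hY

lemma secondFundamentalForm_eq_linear (h : SemiRiemannianMetric I M) (g : SemiRiemannianMetric J N)
    {F : M → N} (hF : ContMDiff I J ∞ F) (x : M) :
    ∃ B : TangentSpace I x →ₗ[ℝ] TangentSpace I x →ₗ[ℝ] TangentSpace J (F x),
      secondFundamentalForm h g hF x = fun v w ↦ B v w :=
  ⟨LinearMap.mk₂ ℝ (secondFundamentalForm h g hF x) (by simp [secondFundamentalForm])
    (by simp [secondFundamentalForm]) (by simp [secondFundamentalForm])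
    (by simp [secondFundamentalForm]), rfl⟩

/-- The endomorphism `A` at `y` in the coordinates of the preferred chart at `c`. -/
noncomputable def coordEndomorphism (A : Π y : N, TangentSpace J y →L[ℝ] TangentSpace J y) (c y : N) :
    E' →L[ℝ] E' :=
  toCoord c y ∘L A y ∘L ofCoord c y

lemma mdifferentiableAt_coordEndomorphism {A : Π y : N, TangentSpace J y →L[ℝ] TangentSpace J y}
    {c : N} (hA : MDifferentiableAt J (J.prod 𝓘(ℝ, E' →L[ℝ] E'))
      (fun y ↦ Bundle.TotalSpace.mk' (E' →L[ℝ] E') y (A y)) c) :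
    MDiffAt (coordEndomorphism A c) c := by
  rw [mdifferentiableAt_section] at hA
  refine hA.congr_of_eventuallyEq ?_
  filter_upwards [(chartAt H' c).open_source.mem_nhds (mem_chart_source H' c)] with y hy
  ext v
  simp [hom_trivializationAt_apply, ContinuousLinearMap.inCoordinates, ofCoord, toCoord,
    coordEndomorphism]

/-- Inserting `ofCoord` after `toCoord` is legitimate only over the chart domain; continuity of `F`
keeps `F y` there for `y` near `x`. -/
lemma toCoord_endomorphism_eventuallyEq (A : Π y : N, TangentSpace J y →L[ℝ] TangentSpace J y)
    {F : M → N} {x : M} (hF : ContinuousAt F x) {V : Π y : M, TangentSpace J (F y)} :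
    (fun y ↦ toCoord (F x) (F y) (A (F y) (V y)))
      =ᶠ[nhds x] fun y ↦ coordEndomorphism A (F x) (F y) (toCoord (F x) (F y) (V y)) := by
  filter_upwards [hF.preimage_mem_nhds
    ((chartAt H' (F x)).open_source.mem_nhds (mem_chart_source H' (F x)))] with y hy
  simp only [coordEndomorphism, ContinuousLinearMap.comp_apply]
  rw [ofCoord_toCoord hy]

lemma mdifferentiableAt_endomorphism_along {A : Π y : N, TangentSpace J y →L[ℝ] TangentSpace J y}
    {F : M → N} {x : M} (hA : MDifferentiableAt J (J.prod 𝓘(ℝ, E' →L[ℝ] E'))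
      (fun y ↦ Bundle.TotalSpace.mk' (E' →L[ℝ] E') y (A y)) (F x))
    (hF : MDifferentiableAt I J F x) {V : Π y : M, TangentSpace J (F y)}
    (hV : MDiffAt (fun y ↦ toCoord (F x) (F y) (V y)) x) :
    MDiffAt (fun y ↦ toCoord (F x) (F y) (A (F y) (V y))) x := by
  have hqF : MDiffAt (fun y ↦ coordEndomorphism A (F x) (F y)) x :=
    (mdifferentiableAt_coordEndomorphism hA).comp x hF
  exact (hqF.clm_apply hV).congr_of_eventuallyEq
    (toCoord_endomorphism_eventuallyEq A hF.continuousAt)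

/-- The Leibniz rule `∇^F_v (Q V) = (∇_{F_* v} Q) V + Q (∇^F_v V)`. -/
lemma SemiRiemannianMetric.covAlong_endomorphism (g : SemiRiemannianMetric J N)
    (Q : AlmostProductStructure J N) {F : M → N} {x : M} (hF : MDifferentiableAt I J F x)
    {V : Π y : M, TangentSpace J (F y)} (hV : MDiffAt (fun y ↦ toCoord (F x) (F y) (V y)) x)
    (v : TangentSpace I x) :
    g.covAlong (I := I) F (fun y ↦ Q.val (F y) (V y)) x v
      = Q.nabla g (F x) (mfderiv I J F x v) (V x) + Q.val (F x) (g.covAlong F V x v) := by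
  have hs := mem_chart_source H' (F x)
  have hq := mdifferentiableAt_coordEndomorphism
    (Q.contMDiff.mdifferentiable (by simp) (F x))
  set q := coordEndomorphism Q.val (F x) with hq_def
  have hqF : MDiffAt (fun y ↦ q (F y)) x := hq.comp x hF
  have hval (w : E') : Q.val (F x) (ofCoord (F x) (F x) w) = ofCoord (F x) (F x) (q (F x) w) := by
    simp only [hq_def, coordEndomorphism, ContinuousLinearMap.comp_apply]
    rw [ofCoord_toCoord hs]
  have hto (w : TangentSpace J (F x)) :
      toCoord (F x) (F x) (Q.val (F x) w) = q (F x) (toCoord (F x) (F x) w) := by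
    simp only [hq_def, coordEndomorphism, ContinuousLinearMap.comp_apply]
    rw [ofCoord_toCoord hs]
  have hQV := toCoord_endomorphism_eventuallyEq Q.val hF.continuousAt (V := V)
  set w := toCoord (F x) (F x) (V x) with hw
  -- `V` need not extend to a field on N, but ∇Q is tensorial, so it may be computed on the
  -- constant-coordinate field through `V x`. The coordinates of Q on that field are the matrix `q`
  -- applied to the fixed vector `w`, by definition.
  have hQZ : (fun z ↦ toCoord (F x) z (Q.val z (constField (F x) (V x) z)))
      =ᶠ[nhds (F x)] fun z ↦ q z w := .rfl
  have hn := Q.nabla_apply g (mfderiv I J F x v) (mdifferentiableAt_constField (F x) (V x))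
  rw [constField_self] at hn
  rw [hn, g.leviCivita_apply, g.leviCivita_apply, hQZ.mvfderiv_eq,
    (toCoord_constField_eventuallyEq (I := J) (F x) (V x)).mvfderiv_eq]
  have hchain : mvfderiv I (fun y ↦ q (F y) w) x v
      = mvfderiv J (fun z ↦ q z w) (F x) (mfderiv I J F x v) := by
    have hqw : MDiffAt (fun z ↦ q z w) (F x) := hq.clm_apply mdifferentiableAt_const
    exact congr($(mfderiv_comp x hqw hF) v)
  -- What remains is ∂_v((q ∘ F)V) = (∂_{F_* v} q)w + q ∂_v V. The terms Γ(F_* v, q w) agree on the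
  -- two sides, and the two copies of q Γ(F_* v, w) on the right cancel.
  simp only [covAlong, ContinuousLinearMap.comp_apply, add_apply, ContinuousLinearMap.flip_apply,
    constField_self, hto, hval, mvfderiv_const]
  rw [hQV.mvfderiv_eq, mvfderiv_clm_apply hqF hV, hchain, ← hw]
  simp
  abel

/-! ### Symmetry of the second fundamental form -/

/-- The tangent-bundle trivializations are the derivatives of the charts, so this is the chain rule.
It is needed at all `y` near `x`, with charts fixed at `x` and `F x`, so that it can be
differentiated once more. -/
lemma toCoord_mfderiv_ofCoord {F : M → N} (hF : ContMDiff I J ∞ F) {x y : M}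
    (hy : y ∈ (chartAt H x).source) (hFy : F y ∈ (chartAt H' (F x)).source) (w : E) :
    toCoord (F x) (F y) (mfderiv I J F y (ofCoord x y w))
      = fderivWithin ℝ (writtenInExtChartAt I J x F) (Set.range I) (extChartAt I x y) w := by
  have h1 : (toCoord (F x) (F y) : TangentSpace J (F y) →L[ℝ] E')
      = mfderiv J 𝓘(ℝ, E') (extChartAt J (F x)) (F y) :=
    TangentBundle.continuousLinearMapAt_trivializationAt (I := J) hFy
  have h2 : (ofCoord x y : E →L[ℝ] TangentSpace I y) = mfderivWithin 𝓘(ℝ, E) I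
      (extChartAt I x).symm (Set.range I) (extChartAt I x y) :=
    TangentBundle.symmL_trivializationAt (I := I) hy
  have hy' : y ∈ (extChartAt I x).source := by simpa using hy
  have hyx : (extChartAt I x).symm (extChartAt I x y) = y := (extChartAt I x).left_inv hy'
  have hu : UniqueMDiffWithinAt 𝓘(ℝ, E) (Set.range I) (extChartAt I x y) :=
    (I.uniqueDiffOn.uniqueDiffWithinAt
      (extChartAt_target_subset_range x ((extChartAt I x).map_source hy'))).uniqueMDiffWithinAt
  have hsymm : MDifferentiableWithinAt 𝓘(ℝ, E) I (extChartAt I x).symm (Set.range I)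
      (extChartAt I x y) :=
    mdifferentiableWithinAt_extChartAt_symm ((extChartAt I x).map_source hy')
  have hFd : MDifferentiableAt I J F y := hF.mdifferentiable (by simp) y
  have hψ : MDifferentiableAt J 𝓘(ℝ, E') (extChartAt J (F x)) (F y) :=
    mdifferentiableAt_extChartAt hFy
  rw [h1, h2, ← mfderivWithin_eq_fderivWithin]
  have e1 := mfderiv_comp_mfderivWithin_of_eq (hψ.comp y hFd) hsymm hu hyx
  have e2 := mfderiv_comp y hψ hFd
  have e3 := congr($e1 w)
  rw [e2] at e3
  exact e3.symm

/-- The second fundamental form is symmetric. -/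
lemma secondFundamentalForm_comm (h : SemiRiemannianMetric I M) (g : SemiRiemannianMetric J N)
    {F : M → N} (hF : ContMDiff I J ∞ F) (x : M) (v w : TangentSpace I x) :
    secondFundamentalForm h g hF x v w = secondFundamentalForm h g hF x w v := by
  set f := writtenInExtChartAt I J x F with hf_def
  have hxr : extChartAt I x x ∈ Set.range I := Set.mem_range_self _
  have hf : ContDiffWithinAt ℝ ∞ f (Set.range I) (extChartAt I x x) :=
    (contMDiffAt_iff.1 (hF x)).2
  have hdf : DifferentiableWithinAt ℝ (fderivWithin ℝ f (Set.range I)) (Set.range I)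
      (extChartAt I x x) :=
    (hf.fderivWithin_right (m := 1) I.uniqueDiffOn (by norm_cast)
      hxr).differentiableWithinAt one_ne_zero
  have hsymm : IsSymmSndFDerivWithinAt ℝ f (Set.range I) (extChartAt I x x) :=
    hf.isSymmSndFDerivWithinAt (by simp; norm_cast)
      I.uniqueDiffOn (I.range_subset_closure_interior hxr) hxr
  have hs := mem_chart_source H x
  -- For the constant-coordinate extension of `b`, the partial derivative of its push-forward is the
  -- ordinary second derivative D²f(a, b) of the chart expression `f`.
  have key (a b : TangentSpace I x) :
      mvfderiv I (fun y ↦ toCoord (F x) (F y) (mfderiv I J F y (constField x b y))) x a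
        = fderivWithin ℝ (fderivWithin ℝ f (Set.range I)) (Set.range I) (extChartAt I x x)
          a (toCoord x x b) := by
    have hY := mdifferentiableAt_pushforward hF (mdifferentiableAt_constField x b)
    rw [mvfderiv_eq_fderivWithin hY]
    have hev : ((fun y ↦ toCoord (F x) (F y) (mfderiv I J F y (constField x b y))) ∘
        (extChartAt I x).symm) =ᶠ[nhdsWithin (extChartAt I x x) (Set.range I)]
        fun u ↦ fderivWithin ℝ f (Set.range I) u (toCoord x x b) := by
      have hc : ∀ᶠ u in nhdsWithin (extChartAt I x x) (Set.range I),
          F ((extChartAt I x).symm u) ∈ (chartAt H' (F x)).source := by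
        have h1 : ContinuousAt (F ∘ (extChartAt I x).symm) (extChartAt I x x) := by
          refine ContinuousAt.comp ?_ (continuousAt_extChartAt_symm x)
          rw [extChartAt_to_inv]
          exact hF.continuous.continuousAt
        have h2 : (chartAt H' (F x)).source
            ∈ nhds ((F ∘ (extChartAt I x).symm) (extChartAt I x x)) := by
          rw [Function.comp_apply, extChartAt_to_inv]
          exact (chartAt H' (F x)).open_source.mem_nhds (mem_chart_source H' _)
        exact nhdsWithin_le_nhds (h1.preimage_mem_nhds h2)
      filter_upwards [extChartAt_target_mem_nhdsWithin x, hc] with u hu hFu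
      have hy : (extChartAt I x).symm u ∈ (chartAt H x).source := by
        simpa using (extChartAt I x).map_target hu
      have := toCoord_mfderiv_ofCoord hF hy hFu (toCoord x x b)
      rwa [(extChartAt I x).right_inv hu] at this
    rw [hev.fderivWithin_eq_of_mem hxr]
    have h3 := fderivWithin_clm_apply (I.uniqueDiffOn _ hxr) hdf
      (differentiableWithinAt_const (c := toCoord x x b))
    erw [h3]
    simp
    rfl
  -- At its own base point the preferred chart has identity derivative under the identification of
  -- `TangentSpace I x` with `E`.
  have hto (a : TangentSpace I x) : toCoord x x a = a := by
    have h0 : (toCoord x x : TangentSpace I x →L[ℝ] E) = mfderiv I 𝓘(ℝ, E) (extChartAt I x) x :=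
      TangentBundle.continuousLinearMapAt_trivializationAt (I := I) hs
    rw [h0, mfderiv_extChartAt_self]
    rfl
  -- Each of the three terms is symmetric: the second derivative by Schwarz, the two Christoffel
  -- terms by torsion-freeness.
  have expand (a b : TangentSpace I x) : secondFundamentalForm h g hF x a b
      = ofCoord (F x) (F x) (fderivWithin ℝ (fderivWithin ℝ f (Set.range I)) (Set.range I)
          (extChartAt I x x) a b
        + g.christoffel (F x) (toCoord (F x) (F x) (mfderiv I J F x a))
          (toCoord (F x) (F x) (mfderiv I J F x b)))
        - mfderiv I J F x (ofCoord x x (h.christoffel x (toCoord x x a) (toCoord x x b))) := by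
    have h1 := secondFundamentalForm_apply h g hF a (mdifferentiableAt_constField x b)
    rw [constField_self] at h1
    rw [h1, h.leviCivita_apply, (toCoord_constField_eventuallyEq x b).mvfderiv_eq]
    simp only [SemiRiemannianMetric.covAlong, ContinuousLinearMap.comp_apply, add_apply,
      ContinuousLinearMap.flip_apply, key, constField_self, mvfderiv_const]
    rw [show (toCoord x x b : E) = b from hto b]
    simp
  rw [expand, expand, g.christoffel_comm, h.christoffel_comm]
  congr 3
  exact hsymm v w

/-! ### Consequences of F_* P = λ Q F_* -/

/-- Differentiating `F_* P = λ Q F_*` gives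
`(∇F_*)(v, P w) + F_* ((∇_v P) w) = λ ((∇_{F_* v} Q) F_* w + Q (∇F_*)(v, w))`. -/
lemma secondFundamentalForm_val (h : SemiRiemannianMetric I M) (g : SemiRiemannianMetric J N)
    (P : AlmostProductStructure I M) (Q : AlmostProductStructure J N) {F : M → N}
    (hF : ContMDiff I J ∞ F) {lam : ℝ}
    (hPQ : ∀ (x : M) (v : TangentSpace I x),
      mfderiv I J F x (P.val x v) = lam • Q.val (F x) (mfderiv I J F x v))
    (x : M) (v w : TangentSpace I x) :
    secondFundamentalForm h g hF x v (P.val x w) + mfderiv I J F x (P.nabla h x v w)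
      = lam • (Q.nabla g (F x) (mfderiv I J F x v) (mfderiv I J F x w)
        + Q.val (F x) (secondFundamentalForm h g hF x v w)) := by
  have hY := mdifferentiableAt_constField x w
  have hPY : MDiffAt (T% (fun y ↦ P.val y (constField x w y))) x :=
    (P.contMDiff.mdifferentiable (by simp) x).clm_bundle_apply hY
  have hFd : MDifferentiableAt I J F x := hF.mdifferentiable (by simp) x
  have h1 := secondFundamentalForm_apply h g hF v hY
  have h2 := secondFundamentalForm_apply h g hF v hPY
  have h3 := P.nabla_apply h v hY
  have h4 := g.covAlong_endomorphism Q hFd (mdifferentiableAt_pushforward hF hY) v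
  -- The hypothesis as an equality of fields along `F`. The scalar is written as a constant function
  -- so that the Leibniz rule applies; its derivative then vanishes.
  have h5 : (fun y ↦ mfderiv I J F y (P.val y (constField x w y)))
      = ((fun _ ↦ lam : M → ℝ) •
        fun y ↦ Q.val (F y) (mfderiv I J F y (constField x w y))) := by
    ext y
    exact hPQ y _
  have hQV : MDiffAt (fun y ↦ toCoord (F x) (F y)
      (Q.val (F y) (mfderiv I J F y (constField x w y)))) x :=
    mdifferentiableAt_endomorphism_along (Q.contMDiff.mdifferentiable (by simp) (F x)) hFd
      (mdifferentiableAt_pushforward hF hY)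
  rw [h5, g.covAlong_smul mdifferentiableAt_const hQV] at h2
  simp only [constField_self, add_apply, smul_apply, mvfderiv_const, h4] at h1 h2 h3 h4
  rw [h2, h3, h1]
  -- Matches the term F_* P ∇_v Y, left by expanding ∇P, with λQ F_* ∇_v Y, left by expanding Q B(v,
  -- w).
  have h6 := hPQ x (h.leviCivita (constField x w) x v)
  simp only [map_sub, h6]
  simp
  module

/-- The pointwise form of the theorem: the contribution of one pair (v, Pv), up to the factor h(v,
v). -/
lemma secondFundamentalForm_sub_val (h : SemiRiemannianMetric I M) (g : SemiRiemannianMetric J N)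
    (P : AlmostProductStructure I M) (Q : AlmostProductStructure J N) {F : M → N}
    (hF : ContMDiff I J ∞ F) {lam : ℝ} (hlam : lam * lam = 1)
    (hPQ : ∀ (x : M) (v : TangentSpace I x),
      mfderiv I J F x (P.val x v) = lam • Q.val (F x) (mfderiv I J F x v))
    (x : M) (v : TangentSpace I x) :
    secondFundamentalForm h g hF x v v - secondFundamentalForm h g hF x (P.val x v) (P.val x v)
      = -Q.val (F x) (Q.sTensor g (F x) (mfderiv I J F x v) (mfderiv I J F x v)
        - lam • mfderiv I J F x (P.nabla h x v v - P.nabla h x (P.val x v) (P.val x v))) := by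
  obtain ⟨D, hD⟩ := Q.nabla_eq_linear g (F x)
  have h1 := secondFundamentalForm_val h g P Q hF hPQ x v v
  have h2 := secondFundamentalForm_val h g P Q hF hPQ x (P.val x v) v
  have h3 := hPQ x (P.nabla h x (P.val x v) (P.val x v))
  -- Now `h3` reads -F_*((∇_{Pv} P)v) = λQ F_*((∇_{Pv} P)Pv), which turns the P-derivative in `h2`
  -- into the one occurring in div P.
  rw [P.val_nabla, P.val_val, map_neg] at h3
  -- Symmetry makes the mixed term B(v, Pv), as in `h1`; F_* Pv = λQv' supplies a second λ, so
  -- ∇_{Qv'} Q appears with coefficient λ² = 1.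
  rw [secondFundamentalForm_comm h g hF x (P.val x v) v, hPQ x v] at h2
  -- As (λQ)² = Id, applying λQ isolates B(v, v) and produces the same λQ B(v, Pv) as in `h2`.
  have h4 := congrArg (fun z ↦ lam • Q.val (F x) z) h1
  simp only [AlmostProductStructure.sTensor, hD, map_add, map_sub, map_smul, smul_add,
    smul_smul, hlam, one_smul, Q.val_val, LinearMap.smul_apply] at h2 h3 h4 ⊢
  linear_combination (norm := module) -h3 - h2 - h4

end Map

/-! ### The tension field formula -/

theorem mainTheorem7
    {E : Type*} [NormedAddCommGroup E] [NormedSpace ℝ E] [FiniteDimensional ℝ E]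
    {H : Type*} [TopologicalSpace H] {I : ModelWithCorners ℝ E H} [I.Boundaryless]
    {M : Type*} [TopologicalSpace M] [ChartedSpace H M] [IsManifold I ∞ M]
    {E' : Type*} [NormedAddCommGroup E'] [NormedSpace ℝ E'] [FiniteDimensional ℝ E']
    {H' : Type*} [TopologicalSpace H'] {J : ModelWithCorners ℝ E' H'} [J.Boundaryless]
    {N : Type*} [TopologicalSpace N] [ChartedSpace H' N] [IsManifold J ∞ N]
    (h : SemiRiemannianMetric I M) (P : AlmostProductStructure I M)
    (hP : IsAlmostParaHermitian h P)
    (g : SemiRiemannianMetric J N) (Q : AlmostProductStructure J N)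
    (hQ : IsAlmostParaHermitian g Q ∨ IsAlmostProductRiemannian g Q)
    (F : M → N) (hF : ContMDiff I J ∞ F) (lam : ℝ)
    (hlam : (lam = 1 ∧ IsParaholomorphic P Q F) ∨ (lam = -1 ∧ IsAntiParaholomorphic P Q F))
    (m : ℕ) (U : Set M) (hU : IsOpen U) (e : Fin m → Π x : M, TangentSpace I x)
    (he : IsOrthonormalFrameOn h
      (Sum.elim e (fun i x ↦ P.val x (e i x)) : Fin m ⊕ Fin m → Π x : M, TangentSpace I x) U)
    (x : M) (hx : x ∈ U) :
    tensionField h g hF x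
        = ∑ i, (h.val x (e i x) (e i x) • secondFundamentalForm h g hF x (e i x) (e i x)
          + h.val x (P.val x (e i x)) (P.val x (e i x)) •
            secondFundamentalForm h g hF x (P.val x (e i x)) (P.val x (e i x))) ∧
      tensionField h g hF x
        = -Q.val (F x) ((∑ i, h.val x (e i x) (e i x) •
              Q.sTensor g (F x) (mfderiv I J F x (e i x)) (mfderiv I J F x (e i x)))
            - lam • mfderiv I J F x (P.div h x)) := by
  obtain ⟨hlam', hPQ⟩ : lam * lam = 1 ∧ ∀ (x : M) (v : TangentSpace I x),
      mfderiv I J F x (P.val x v) = lam • Q.val (F x) (mfderiv I J F x v) := by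
    rcases hlam with ⟨rfl, h'⟩ | ⟨rfl, h'⟩
    · exact ⟨by norm_num, fun x v ↦ by rw [h' x v, one_smul]⟩
    · exact ⟨by norm_num, fun x v ↦ by rw [h' x v, neg_one_smul]⟩
  have hτ : tensionField h g hF x
      = ∑ i, (h.val x (e i x) (e i x) • secondFundamentalForm h g hF x (e i x) (e i x)
          + h.val x (P.val x (e i x)) (P.val x (e i x)) •
            secondFundamentalForm h g hF x (P.val x (e i x)) (P.val x (e i x))) := by
    obtain ⟨B, hB⟩ := secondFundamentalForm_eq_linear h g hF x
    rw [tensionField, hB, he.trace_eq_sum hx, Fintype.sum_sum_type, Finset.sum_add_distrib]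
    rfl
  -- Compatibility of P with `h` enters here: it turns the traces into sums of differences weighted
  -- by h(e_i, e_i).
  have hε (i : Fin m) : h.val x (P.val x (e i x)) (P.val x (e i x)) = -h.val x (e i x) (e i x) := by
    rw [hP x, P.val_val]
  refine ⟨hτ, ?_⟩
  have hdiv : P.div h x = ∑ i, h.val x (e i x) (e i x) • (P.nabla h x (e i x) (e i x)
      - P.nabla h x (P.val x (e i x)) (P.val x (e i x))) := by
    rw [P.div_eq_sum h he hx, Fintype.sum_sum_type, ← Finset.sum_add_distrib]
    refine Finset.sum_congr rfl fun i _ ↦ ?_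
    simp only [Sum.elim_inl, Sum.elim_inr, hε]
    module
  rw [hτ, hdiv, map_sum, Finset.smul_sum, ← Finset.sum_sub_distrib, map_sum,
    ← Finset.sum_neg_distrib]
  refine Finset.sum_congr rfl fun i _ ↦ ?_
  have key := secondFundamentalForm_sub_val h g P Q hF hlam' hPQ x (e i x)
  rw [hε, neg_smul, ← sub_eq_add_neg, ← smul_sub, key, map_smul, smul_comm lam, ← smul_sub,
    map_smul, smul_neg]
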